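/- Let $p(x)=\mathrm{mid}\{0,1,x\}=\max\{0,\min\{1,x\}\}$. Fix a target $Q^*\in[0,1]$ and constants $\alpha_0>0$, $0<\beta_0\le 1$ and $w>0$. For $\epsilon>0$ put $\alpha=\epsilon^{3/2}\alpha_0$, $\beta=\epsilon\beta_0 w$ and $\gamma=1-\epsilon w$. Consider $n$ agents with constants $q_1,\dots,q_n\in\mathbb R$, and binary ($\{0,1\}$-valued) random variables $M_i(k)$ ($1\le i\le n$, $k=0,1,2,\dots$), a global signal $C(k)$ and individual signals $c_i(k)$, with deterministic initial values $C(0)$ and $c_i(0)$, such that for all $k\ge 0$ and all $i$ \[ C(k+1)=C(k)+\alpha\Big(Q^*-\frac1n\sum_{i=1}^n M_i(k)\Big),\qquad c_i(k+1)=c_i(k)+\beta\big(Q^*-\overline{M_i(k)}\big), \] where \[ \overline{M_i(k)}=(1-\gamma)\sum_{j=1}^{k}\gamma^{k-j}M_i(j). \] Let $\mathcal F(k)$ be the $\sigma$-algebra generated by $\{M_i(j):1\le i\le n,\ 1\le j\le k\}$, and suppose that for every $k\ge 0$ the variables $M_1(k+1),\dots,M_n(k+1)$ are conditionally independent given $\mathcal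 F(k)$, with \[ \mathbb P\big(M_i(k+1)=1\mid\mathcal F(k)\big)=p\big(q_i+C(k)+c_i(k)\big)\quad\text{almost surely}. \] Then there are positive constants $B,\epsilon_0$, depending only on $Q^*,\alpha_0,\beta_0,w$, such that for all $0<\epsilon<\epsilon_0$, for all such processes whose initial values satisfy $0\le q_i+C(0)+c_i(0)\le 1$ for every $i$, for all $\delta>0$ and all $i\in\{1,\dots,n\}$, \[ \limsup_{k\to\infty}\mathbb P\big(|\overline{M_i(k)}-Q^*|>\delta\big)\le B\,\delta^{-2}\,\epsilon . \] -/

import Mathlib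

open MeasureTheory ProbabilityTheory Filter

noncomputable section

/-- The compliance probability `p(x) = mid {0, 1, x}`: the identity on `(0, 1)`, equal to `0` for
`x ≤ 0` and to `1` for `x ≥ 1`. -/
def midProb (x : ℝ) : ℝ := max 0 (min 1 x)

/-- The exponentially windowed time average
`(1 - γ) * ∑_{j = 1}^{k} γ ^ (k - j) * m j` of a sequence `m`. -/
def windowAvg (γ : ℝ) (m : ℕ → ℝ) (k : ℕ) : ℝ :=
  (1 - γ) * ∑ j ∈ Finset.Icc 1 k, γ ^ (k - j) * m j

/-- The σ-algebra `F(k)` generated by the random variables `M i j`, `1 ≤ j ≤ k`, over all agents `i`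
(trivial for `k = 0`). -/
abbrev complianceHistory {Ω : Type*} {n : ℕ} (M : Fin n → ℕ → Ω → ℝ) (k : ℕ) : MeasurableSpace Ω :=
  ⨆ i : Fin n, ⨆ j ∈ Finset.Icc 1 k, MeasurableSpace.comap (M i j) (borel ℝ)

/-- The processes `M i k` (compliance of agent `i` at time `k`), `C k` (global signal) and `c i k`
(individual signals) form a compliance process under `μ`, with proclivities `q`, target `Q`, gains
`α`, `β` and averaging parameter `γ`. -/
structure IsComplianceProcess {Ω : Type*} [MeasurableSpace Ω] (μ : Measure Ω) {n : ℕ}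
    (q : Fin n → ℝ) (Q α β γ : ℝ)
    (M : Fin n → ℕ → Ω → ℝ) (C : ℕ → Ω → ℝ) (c : Fin n → ℕ → Ω → ℝ) : Prop where
  /-- Each `M i k` is a random variable. -/
  measurable : ∀ i k, Measurable (M i k)
  /-- Each `M i k` is binary. -/
  binary : ∀ i k ω, M i k ω = 0 ∨ M i k ω = 1
  /-- The proportional law of the global signal. -/
  global_law : ∀ k ω, C (k + 1) ω = C k ω + α * (Q - (n : ℝ)⁻¹ * ∑ i, M i k ω)
  /-- The proportional law of the individual signals. -/
  individual_law : ∀ i k ω,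
    c i (k + 1) ω = c i k ω + β * (Q - windowAvg γ (fun j => M i j ω) k)
  /-- The conditional probability of compliance at time `k + 1` given `F(k)`. -/
  cond_prob : ∀ i k, μ⟦{ω | M i (k + 1) ω = 1} | complianceHistory M k⟧
    =ᵐ[μ] fun ω => midProb (q i + C k ω + c i k ω)
  /-- The variables `M i (k + 1)`, over the agents `i`, are conditionally independent given `F(k)`:
  the conditional probabilities of joint events factorize. -/
  cond_indep : ∀ (k : ℕ) (S : Finset (Fin n)) (A : Fin n → Set ℝ), (∀ i, MeasurableSet (A i)) →
    μ⟦⋂ i ∈ S, M i (k + 1) ⁻¹' A i | complianceHistory M k⟧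
      =ᵐ[μ] fun ω => ∏ i ∈ S, (μ⟦M i (k + 1) ⁻¹' A i | complianceHistory M k⟧) ω

end

/-!
Fix an agent and write `z` for the deviation of its windowed average from the target `Q`, `y` for
the deviation of its signal and `φ y = p (y + Q) - Q` for its saturated response
(`centeredProb`). On the time scale `1 / (ε w)` the loop is a noisy perturbation of
`z' = φ y - z`, `y' = -β₀ z`.

For `0 < Q < 1`, let `Φ` be the primitive of `φ` (`responsePotential`). The energy
`z ^ 2 / 2 + Φ y / β₀` dissipates `z ^ 2` along this flow, and subtracting the small cross term
`z φ(y) / 4` gives a function `V` (`lyapunov`) that dissipates a multiple of `z ^ 2 + φ(y) ^ 2`.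
In discrete time the dissipation is of order `ε`. The second-order terms are of order `ε ^ 2`, and
the drift of the global signal, of order `ε ^ (3 / 2)`, is linear in `z` and `φ(y)`, so that by
Young's inequality it too costs only `ε ^ 2` (`lyapunov_step`). The dissipation is bounded while `V`
is not, so `V` itself does not contract; but the steps of `V` are bounded by a multiple of `ε` and
the dissipation dominates `1 - exp (-V)`, so `exp V - 1` contracts at rate of order `ε`, up to an
error of order `ε ^ 2` and a term linear in the innovation (`exists_exp_lyapunov_step`). The
innovation is orthogonal to the history (`integral_mul_innovation`), hence the limit superior of the
expectation of `exp V - 1 ≥ z ^ 2 / 4` is of order `ε`, and Markov's inequality concludes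
(`exists_limsup_le`). Only the conditional law of each agent's compliance is used; the other agents
enter through the global signal, whose steps are bounded by `α`.

The variables `M j 0` enter the signals but not the history, so the signal is replaced by
`signalDeviation`, which drops their contribution; the difference is at most one global step.

For `Q = 0` or `Q = 1` the restoring force vanishes on one side, but the signal is monotone: either
it reaches the saturated range, after which the windowed average decays to `Q` geometrically, or its
total variation is bounded and makes the deviations of the windowed average summable
(`tendsto_zero_of_drift`). The windowed average then tends to `Q` almost surely, and the limit
superior is `0` (`limsup_eq_zero_of_ae_tendsto`).
-/

open MeasureTheory ProbabilityTheory Filter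

/-! ### The saturated response and its potential -/

noncomputable section

/-- The compliance probability centred at the target: the deviation `p (y + Q) - Q` of the
compliance probability from `Q` when the signal deviates from `Q` by `y`. -/
def centeredProb (Q y : ℝ) : ℝ := midProb (y + Q) - Q

/-- For `0 ≤ Q ≤ 1`, the primitive of `centeredProb Q` vanishing at `0`, written in Legendre form:
it is the maximum of `u * y - u ^ 2 / 2` over `u ∈ [-Q, 1 - Q]`. -/
def responsePotential (Q y : ℝ) : ℝ := centeredProb Q y * y - centeredProb Q y ^ 2 / 2

/-- The Lyapunov function in the deviation `z` of the windowed average and the deviation `y` of the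
signal. The first two terms are an energy that dissipates only `z ^ 2`; the cross term makes it
dissipate `centeredProb Q y ^ 2` as well. -/
def lyapunov (Q b z y : ℝ) : ℝ :=
  z ^ 2 / 2 + responsePotential Q y / b - z * centeredProb Q y / 4

end

lemma midProb_nonneg (x : ℝ) : 0 ≤ midProb x := le_max_left _ _

lemma midProb_le_one (x : ℝ) : midProb x ≤ 1 := max_le zero_le_one (min_le_left _ _)

lemma midProb_of_nonpos {x : ℝ} (hx : x ≤ 0) : midProb x = 0 :=
  max_eq_left ((min_le_right _ _).trans hx)

lemma midProb_of_one_le {x : ℝ} (hx : 1 ≤ x) : midProb x = 1 := by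
  simp [midProb, min_eq_left hx]

lemma continuous_midProb : Continuous midProb := by
  unfold midProb; fun_prop

lemma abs_midProb_sub_le (x y : ℝ) : |midProb x - midProb y| ≤ |x - y| := by
  unfold midProb
  rw [max_comm 0, max_comm 0]
  refine (abs_max_sub_max_le_abs _ _ _).trans ?_
  simpa using abs_min_sub_min_le_max 1 x 1 y

lemma continuous_centeredProb (Q : ℝ) : Continuous (centeredProb Q) := by
  unfold centeredProb
  have := continuous_midProb
  fun_prop

lemma neg_le_centeredProb (Q y : ℝ) : -Q ≤ centeredProb Q y := by
  have := midProb_nonneg (y + Q)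
  unfold centeredProb; linarith

lemma centeredProb_le (Q y : ℝ) : centeredProb Q y ≤ 1 - Q := by
  have := midProb_le_one (y + Q)
  unfold centeredProb; linarith

lemma abs_centeredProb_le_one {Q : ℝ} (hQ0 : 0 ≤ Q) (hQ1 : Q ≤ 1) (y : ℝ) :
    |centeredProb Q y| ≤ 1 :=
  abs_le.2 ⟨by linarith [neg_le_centeredProb Q y], by linarith [centeredProb_le Q y]⟩

lemma abs_centeredProb_sub_le (Q y y' : ℝ) :
    |centeredProb Q y' - centeredProb Q y| ≤ |y' - y| := by
  simpa [centeredProb] using abs_midProb_sub_le (y' + Q) (y + Q)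

lemma centeredProb_cases (Q y : ℝ) :
    centeredProb Q y = y ∨ (centeredProb Q y = -Q ∧ y ≤ -Q) ∨
      (centeredProb Q y = 1 - Q ∧ 1 - Q ≤ y) := by
  unfold centeredProb
  rcases le_total (y + Q) 0 with h | h
  · right; left
    rw [midProb_of_nonpos h]
    constructor <;> linarith
  rcases le_total 1 (y + Q) with h' | h'
  · right; right
    rw [midProb_of_one_le h']
    constructor <;> linarith
  · left
    rw [midProb, min_eq_right h', max_eq_right h]
    ring

lemma mul_sub_sq_le_responsePotential {Q u : ℝ} (h0 : -Q ≤ u) (h1 : u ≤ 1 - Q) (y : ℝ) :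
    u * y - u ^ 2 / 2 ≤ responsePotential Q y := by
  unfold responsePotential
  rcases centeredProb_cases Q y with h | ⟨h, hy⟩ | ⟨h, hy⟩ <;> rw [h]
  · nlinarith [sq_nonneg (u - y)]
  · nlinarith [sq_nonneg (u + Q)]
  · nlinarith [sq_nonneg (u - (1 - Q))]

lemma sq_centeredProb_le {Q : ℝ} (hQ0 : 0 ≤ Q) (hQ1 : Q ≤ 1) (y : ℝ) :
    centeredProb Q y ^ 2 / 2 ≤ responsePotential Q y := by
  unfold responsePotential
  rcases centeredProb_cases Q y with h | ⟨h, hy⟩ | ⟨h, hy⟩ <;> rw [h] <;> nlinarith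

/-- The second-order bound for an increment of the potential, from its Legendre form and the
Lipschitz bound on its derivative `centeredProb Q`. -/
lemma responsePotential_sub_le (Q y y' : ℝ) :
    responsePotential Q y' - responsePotential Q y
      ≤ centeredProb Q y * (y' - y) + (y' - y) ^ 2 := by
  have h1 := mul_sub_sq_le_responsePotential (neg_le_centeredProb Q y') (centeredProb_le Q y') y
  have h2 : (centeredProb Q y' - centeredProb Q y) * (y' - y) ≤ (y' - y) ^ 2 := by
    calc _ ≤ |(centeredProb Q y' - centeredProb Q y) * (y' - y)| := le_abs_self _
      _ ≤ |y' - y| * |y' - y| := by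
        rw [abs_mul]
        exact mul_le_mul_of_nonneg_right (abs_centeredProb_sub_le Q y y') (abs_nonneg _)
      _ = _ := by rw [← sq, sq_abs]
  have h3 : responsePotential Q y' = centeredProb Q y' * y' - centeredProb Q y' ^ 2 / 2 := rfl
  nlinarith

/-! ### The Lyapunov function -/

lemma continuous_responsePotential (Q : ℝ) : Continuous (responsePotential Q) := by
  unfold responsePotential
  have := continuous_centeredProb Q
  fun_prop

lemma continuous_lyapunov (Q b : ℝ) : Continuous fun x : ℝ × ℝ => lyapunov Q b x.1 x.2 := by
  unfold lyapunov
  have := continuous_centeredProb Q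
  have := continuous_responsePotential Q
  fun_prop

lemma sq_div_four_le_lyapunov {Q b : ℝ} (hQ0 : 0 ≤ Q) (hQ1 : Q ≤ 1) (hb0 : 0 < b) (hb1 : b ≤ 1)
    (z y : ℝ) : z ^ 2 / 4 ≤ lyapunov Q b z y := by
  unfold lyapunov
  have h1 := sq_centeredProb_le hQ0 hQ1 y
  have h2 : responsePotential Q y ≤ responsePotential Q y / b :=
    le_div_self ((by positivity : (0 : ℝ) ≤ _).trans h1) hb0 hb1
  nlinarith [sq_nonneg (z - centeredProb Q y), sq_nonneg (centeredProb Q y), sq_nonneg z]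

lemma lyapunov_le {Q b z Y : ℝ} (hQ0 : 0 ≤ Q) (hQ1 : Q ≤ 1) (hb0 : 0 < b) (hz : |z| ≤ 1) {y : ℝ}
    (hy : |y| ≤ Y) : lyapunov Q b z y ≤ 1 + Y / b := by
  unfold lyapunov
  have hf := abs_centeredProb_le_one hQ0 hQ1 y
  have h1 : responsePotential Q y ≤ Y := by
    have : centeredProb Q y * y ≤ Y := by
      calc _ ≤ |centeredProb Q y * y| := le_abs_self _
        _ ≤ 1 * |y| := by rw [abs_mul]; gcongr
        _ ≤ Y := by linarith
    unfold responsePotential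
    nlinarith [sq_nonneg (centeredProb Q y)]
  have h2 : responsePotential Q y / b ≤ Y / b := by gcongr
  have h3 : -(z * centeredProb Q y) ≤ 1 := by
    calc _ ≤ |z * centeredProb Q y| := neg_le_abs _
      _ ≤ 1 := by rw [abs_mul]; exact mul_le_one₀ hz (abs_nonneg _) hf
  have h4 : z ^ 2 ≤ 1 := (sq_le_one_iff_abs_le_one z).2 hz
  linarith

/-- The dissipation dominates a saturating function of the Lyapunov function. In the linear range
the two are comparable; in the saturated range the response is bounded away from `0`, which needs
`0 < Q < 1`. -/
lemma one_sub_exp_neg_lyapunov_le {Q b : ℝ} (hQ0 : 0 < Q) (hQ1 : Q < 1) (hb0 : 0 < b) (hb1 : b ≤ 1)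
    (z y : ℝ) :
    min b (min Q (1 - Q) ^ 2) * (1 - Real.exp (-lyapunov Q b z y))
      ≤ z ^ 2 + centeredProb Q y ^ 2 := by
  set c := min b (min Q (1 - Q) ^ 2) with hc
  have hθ : 0 < min Q (1 - Q) := lt_min hQ0 (by linarith)
  have hc0 : 0 < c := lt_min hb0 (by positivity)
  have hsat : ∀ u : ℝ, min Q (1 - Q) ≤ u → c * (1 - Real.exp (-lyapunov Q b z y)) ≤ u ^ 2 := by
    intro u hu
    have h1 : c ≤ u ^ 2 := (min_le_right _ _).trans (by gcongr)
    nlinarith [Real.exp_pos (-lyapunov Q b z y)]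
  rcases centeredProb_cases Q y with h | ⟨h, -⟩ | ⟨h, -⟩
  · have h1 : 1 - Real.exp (-lyapunov Q b z y) ≤ lyapunov Q b z y := by
      linarith [Real.add_one_le_exp (-lyapunov Q b z y)]
    have hV0 : 0 ≤ lyapunov Q b z y :=
      (by positivity : (0 : ℝ) ≤ z ^ 2 / 4).trans
        (sq_div_four_le_lyapunov hQ0.le hQ1.le hb0 hb1 z y)
    have h2 : b * lyapunov Q b z y ≤ z ^ 2 + y ^ 2 := by
      have : b * lyapunov Q b z y = b * (z ^ 2 / 2 - z * y / 4) + y ^ 2 / 2 := by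
        unfold lyapunov responsePotential
        rw [h]
        field_simp
        ring
      rw [this]
      have h3 : z ^ 2 / 2 - z * y / 4 ≤ 5 / 8 * z ^ 2 + y ^ 2 / 8 := by
        nlinarith [sq_nonneg (z + y)]
      have h4 : b * (z ^ 2 / 2 - z * y / 4) ≤ b * (5 / 8 * z ^ 2 + y ^ 2 / 8) := by gcongr
      have h5 : b * (5 / 8 * z ^ 2 + y ^ 2 / 8) ≤ 5 / 8 * z ^ 2 + y ^ 2 / 8 :=
        mul_le_of_le_one_left (by positivity) hb1
      nlinarith [sq_nonneg z, sq_nonneg y]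
    rw [h]
    calc _ ≤ c * lyapunov Q b z y := by gcongr
      _ ≤ b * lyapunov Q b z y := by gcongr; exact min_le_left _ _
      _ ≤ _ := h2
  · have := hsat Q (min_le_left _ _)
    rw [h]
    nlinarith [sq_nonneg z]
  · have := hsat (1 - Q) (min_le_right _ _)
    rw [h]
    nlinarith [sq_nonneg z]

/-- Pathwise one-step bound. `r` is the square root of `ε`, `ε * w` the averaging gain,
`ε * w * b` the individual gain and `ε * r * A` the global gain; `x` is the new compliance and `s` a
signal deviation that may differ from `y` by one global step. -/
lemma lyapunov_step {Q b w A : ℝ} (hQ0 : 0 ≤ Q) (hQ1 : Q ≤ 1) (hb0 : 0 < b) (hb1 : b ≤ 1)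
    (hw : 0 < w) (hA : 0 < A) {ε r z y s d x : ℝ} (hε0 : 0 < ε) (hr0 : 0 ≤ r)
    (hr1 : r ≤ 1) (hrε : r ^ 2 = ε) (hz0 : -Q ≤ z) (hz1 : z ≤ 1 - Q) (hd : |d| ≤ 1)
    (hx0 : 0 ≤ x) (hx1 : x ≤ 1) (hs : |s - y| ≤ ε * r * A) :
    lyapunov Q b (z + ε * w * (x - Q - z)) (y - ε * w * b * z + ε * r * A * d) - lyapunov Q b z y
      ≤ -(w / 16) * ε * (z ^ 2 + centeredProb Q y ^ 2)
        + (w ^ 2 / 2 + (w + A) ^ 2 / b + 2 * w * A + (w ^ 2 + w * A) / 4 + 4 / w * (A / b) ^ 2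
            + A ^ 2 / (4 * w)) * ε ^ 2
        + ε * w * (z - centeredProb Q y / 4) * (x - midProb (s + Q)) := by
  set z' := z + ε * w * (x - Q - z) with hz'
  set y' := y - ε * w * b * z + ε * r * A * d with hy'
  set f := centeredProb Q y with hf
  set f' := centeredProb Q y' with hf'
  set ρ := centeredProb Q s - f with hρ
  set ξ := x - midProb (s + Q) with hξ
  have hxQ : x - Q = ξ + f + ρ := by simp only [hξ, hρ, centeredProb]; ring
  have hzabs : |z| ≤ 1 := abs_le.2 ⟨by linarith, by linarith⟩
  have hfabs : |f| ≤ 1 := abs_centeredProb_le_one hQ0 hQ1 y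
  have hρabs : |ρ| ≤ ε * r * A := (abs_centeredProb_sub_le Q y s).trans hs
  have hrε' : ε * r ≤ ε := mul_le_of_le_one_right hε0.le hr1
  have hα : ε * r * A ≤ ε * A := by gcongr
  -- the kinetic term
  have h1 : z' ^ 2 / 2 - z ^ 2 / 2 ≤ ε * w * z * (x - Q - z) + w ^ 2 / 2 * ε ^ 2 := by
    have : (x - Q - z) ^ 2 ≤ 1 := by
      rw [sq_le_one_iff_abs_le_one]; exact abs_le.2 ⟨by linarith, by linarith⟩
    have h : z' ^ 2 / 2 - z ^ 2 / 2
        = ε * w * z * (x - Q - z) + w ^ 2 / 2 * ε ^ 2 * (x - Q - z) ^ 2 := by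
      rw [hz']; ring
    rw [h]
    have : w ^ 2 / 2 * ε ^ 2 * (x - Q - z) ^ 2 ≤ w ^ 2 / 2 * ε ^ 2 * 1 := by gcongr
    linarith
  have hdy : y' - y = -(ε * w * b * z) + ε * r * A * d := by rw [hy']; ring
  have hdyabs : |y' - y| ≤ ε * w * b * |z| + ε * r * A := by
    rw [hdy]
    refine (abs_add_le _ _).trans ?_
    rw [abs_neg, abs_mul, abs_of_pos (by positivity : 0 < ε * w * b), abs_mul,
      abs_of_nonneg (by positivity : 0 ≤ ε * r * A)]
    have : ε * r * A * |d| ≤ ε * r * A := mul_le_of_le_one_right (by positivity) hd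
    gcongr
  -- the potential term
  have h2 : responsePotential Q y' / b - responsePotential Q y / b
      ≤ -(ε * w * z * f) + ε * r * (A / b) * |f| + (w + A) ^ 2 / b * ε ^ 2 := by
    have hsq : (y' - y) ^ 2 ≤ (ε * (w + A)) ^ 2 := by
      rw [← sq_abs]
      have : |y' - y| ≤ ε * (w + A) := by
        have h3 : ε * w * b * |z| ≤ ε * w * 1 * 1 := by gcongr
        linarith
      gcongr
    have hlin : f * (y' - y) ≤ -(ε * w * b * z * f) + ε * r * A * |f| := by
      have : f * d ≤ |f| := (le_abs_self _).trans <| by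
        rw [abs_mul]; exact mul_le_of_le_one_right (abs_nonneg _) hd
      have : ε * r * A * (f * d) ≤ ε * r * A * |f| := by gcongr
      rw [hdy]; linarith
    have hΦ := responsePotential_sub_le Q y y'
    rw [← sub_div, div_le_iff₀ hb0]
    have e : (-(ε * w * z * f) + ε * r * (A / b) * |f| + (w + A) ^ 2 / b * ε ^ 2) * b
        = -(ε * w * b * z * f) + ε * r * A * |f| + (ε * (w + A)) ^ 2 := by
      field_simp
    rw [e]
    linarith
  -- the cross term
  have h3 : -(z' * f' / 4) + z * f / 4 ≤ -(ε * w * (x - Q - z) * f / 4)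
      + ε * w * z ^ 2 / 4 + ε * r * A * |z| / 4 + (w ^ 2 + w * A) / 4 * ε ^ 2 := by
    have hz'abs : |z'| ≤ |z| + ε * w := by
      have : |x - Q - z| ≤ 1 := abs_le.2 ⟨by linarith, by linarith⟩
      rw [hz']
      refine (abs_add_le _ _).trans ?_
      rw [abs_mul, abs_of_pos (by positivity : 0 < ε * w)]
      have : ε * w * |x - Q - z| ≤ ε * w := mul_le_of_le_one_right (by positivity) this
      gcongr
    have hff : |f' - f| ≤ ε * w * |z| + ε * r * A := by
      refine (abs_centeredProb_sub_le Q y y').trans (hdyabs.trans ?_)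
      have : ε * w * b * |z| ≤ ε * w * 1 * |z| := by gcongr
      linarith
    have hprod : -(z' * (f' - f)) ≤ (|z| + ε * w) * (ε * w * |z| + ε * r * A) := by
      refine (neg_le_abs _).trans ?_
      rw [abs_mul]
      gcongr
    have e1 : ε * w * (ε * w * |z|) ≤ ε * w * (ε * w * 1) := by gcongr
    have e2 : ε * w * (ε * r * A) ≤ ε * w * (ε * A) := by gcongr
    have e3 : |z| * |z| = z ^ 2 := by rw [← sq, sq_abs]
    have e4 : (|z| + ε * w) * (ε * w * |z| + ε * r * A)
        = ε * w * (|z| * |z|) + ε * r * A * |z| + ε * w * (ε * w * |z|)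
          + ε * w * (ε * r * A) := by ring
    rw [e4, e3] at hprod
    have e5 : z' * f' = z * f + ε * w * (x - Q - z) * f + z' * (f' - f) := by rw [hz']; ring
    rw [e5]
    linarith
  have h4 : ε * w * (z - f / 4) * ρ ≤ 2 * w * A * ε ^ 2 := by
    have hzf : |z - f / 4| ≤ 2 := by
      rw [abs_le] at *; constructor <;> linarith [hzabs.1, hzabs.2, hfabs.1, hfabs.2]
    have : (z - f / 4) * ρ ≤ 2 * (ε * A) := (le_abs_self _).trans <| by
      rw [abs_mul]
      exact mul_le_mul hzf (hρabs.trans hα) (abs_nonneg _) zero_le_two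
    have : ε * w * ((z - f / 4) * ρ) ≤ ε * w * (2 * (ε * A)) := by gcongr
    linarith
  -- Young's inequality splits the drift of the global signal, of order `ε ^ (3 / 2)`, into a
  -- part absorbed by the dissipation and a remainder of order `ε ^ 2`.
  have young : ∀ u v : ℝ, r * u * |v| ≤ w / 16 * v ^ 2 + 4 / w * u ^ 2 * ε := by
    intro u v
    have h := sq_nonneg (w * |v| - 8 * (r * u))
    have e : w / 16 * v ^ 2 + 4 / w * u ^ 2 * ε - r * u * |v|
        = (w * |v| - 8 * (r * u)) ^ 2 / (16 * w) := by
      rw [← hrε, ← sq_abs v]; field_simp; ring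
    have : 0 ≤ (w * |v| - 8 * (r * u)) ^ 2 / (16 * w) := by positivity
    linarith
  have h5 : ε * (r * (A / b) * |f|) ≤ ε * (w / 16 * f ^ 2 + 4 / w * (A / b) ^ 2 * ε) := by
    gcongr; exact young _ _
  have h6 : ε * (r * (A / 4) * |z|) ≤ ε * (w / 16 * z ^ 2 + 4 / w * (A / 4) ^ 2 * ε) := by
    gcongr; exact young _ _
  have e6 : 4 / w * (A / 4) ^ 2 = A ^ 2 / (4 * w) := by field_simp
  rw [e6] at h6
  have h7 : ε * w * (z * f / 4) ≤ ε * w * ((z ^ 2 + f ^ 2) / 8) := by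
    have : z * f / 4 ≤ (z ^ 2 + f ^ 2) / 8 := by linarith only [sq_nonneg (z - f)]
    gcongr
  have h8 : 0 ≤ ε * w * z ^ 2 := by positivity
  have hV : lyapunov Q b z' y' - lyapunov Q b z y = (z' ^ 2 / 2 - z ^ 2 / 2)
      + (responsePotential Q y' / b - responsePotential Q y / b)
      + (-(z' * f' / 4) + z * f / 4) := by
    unfold lyapunov; ring
  rw [hV]
  rw [hxQ] at h1 h3
  linarith only [h1, h2, h3, h4, h5, h6, h7, h8]

/-- The exponential of the Lyapunov function contracts at rate of order `ε` up to an error of order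
`ε ^ 2` and a term linear in the innovation `x - midProb (s + Q)`. -/
lemma exists_exp_lyapunov_step {Q b w A : ℝ} (hQ0 : 0 < Q) (hQ1 : Q < 1) (hb0 : 0 < b)
    (hb1 : b ≤ 1) (hw : 0 < w) (hA : 0 < A) :
    ∃ κ > 0, ∃ K > 0, ∃ ε₀ > 0, ε₀ * w ≤ 1 ∧ ε₀ * κ ≤ 1 ∧
      ∀ ε r z y s d x : ℝ, 0 < ε → ε < ε₀ → 0 ≤ r → r ^ 2 = ε → -Q ≤ z → z ≤ 1 - Q → |d| ≤ 1 →
        0 ≤ x → x ≤ 1 → |s - y| ≤ ε * r * A →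
        Real.exp (lyapunov Q b (z + ε * w * (x - Q - z)) (y - ε * w * b * z + ε * r * A * d)) - 1
          ≤ (1 - κ * ε) * (Real.exp (lyapunov Q b z y) - 1) + K * ε ^ 2
            + Real.exp (lyapunov Q b z y) * (ε * w * (z - centeredProb Q y / 4))
              * (x - midProb (s + Q)) := by
  set K₀ := w ^ 2 / 2 + (w + A) ^ 2 / b + 2 * w * A + (w ^ 2 + w * A) / 4 + 4 / w * (A / b) ^ 2
    + A ^ 2 / (4 * w) with hK₀
  have hK₀pos : 0 < K₀ := by positivity
  set c := min b (min Q (1 - Q) ^ 2) with hc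
  have hθ : 0 < min Q (1 - Q) := lt_min hQ0 (by linarith)
  have hc0 : 0 < c := lt_min hb0 (by positivity)
  -- `L * ε` bounds the increment of the Lyapunov function
  set L := w / 8 + K₀ + 2 * w with hL
  have hLpos : 0 < L := by positivity
  set K := K₀ + L ^ 2 with hK
  have hKpos : 0 < K := by positivity
  set κ := w / 16 * c / 2 with hκ
  have hκpos : 0 < κ := by positivity
  refine ⟨κ, hκpos, K, hKpos, min 1 (min (1 / w) (min (1 / κ) (min (1 / L) (κ / K)))),
    by positivity, ?_, ?_, ?_⟩
  · rw [← le_div_iff₀ hw]; exact (min_le_right _ _).trans (min_le_left _ _)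
  · rw [← le_div_iff₀ hκpos]
    exact (min_le_right _ _).trans ((min_le_right _ _).trans (min_le_left _ _))
  intro ε r z y s d x hε hε₀ hr hrε hz0 hz1 hd hx0 hx1 hs
  simp only [lt_min_iff] at hε₀
  obtain ⟨hε1, -, -, hεL, hεK⟩ := hε₀
  rw [lt_div_iff₀ hLpos] at hεL
  rw [lt_div_iff₀ hKpos] at hεK
  have hr1 : r ≤ 1 := by
    rw [← sq_le_one_iff₀ hr]; linarith
  have hstep := lyapunov_step hQ0.le hQ1.le hb0 hb1 hw hA hε hr hr1 hrε hz0 hz1 hd hx0 hx1 hs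
  rw [← hK₀] at hstep
  have hdiss := one_sub_exp_neg_lyapunov_le hQ0 hQ1 hb0 hb1 z y
  rw [← hc] at hdiss
  set V := lyapunov Q b z y with hV
  set V' := lyapunov Q b (z + ε * w * (x - Q - z)) (y - ε * w * b * z + ε * r * A * d) with hV'
  set f := centeredProb Q y with hf
  set ξ := x - midProb (s + Q) with hξ
  set D := z ^ 2 + f ^ 2 with hD
  set U := -(w / 16) * ε * D + K₀ * ε ^ 2 + ε * w * (z - f / 4) * ξ with hU
  have hzabs : |z| ≤ 1 := abs_le.2 ⟨by linarith, by linarith⟩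
  have hfabs : |f| ≤ 1 := abs_centeredProb_le_one hQ0.le hQ1.le y
  have hUabs : |U| ≤ ε * L := by
    have hD0 : 0 ≤ D := by positivity
    have hD2 : D ≤ 2 := by
      have := (sq_le_one_iff_abs_le_one z).2 hzabs
      have := (sq_le_one_iff_abs_le_one f).2 hfabs
      linarith
    have hξabs : |ξ| ≤ 1 := abs_le.2
      ⟨by linarith [midProb_le_one (s + Q)], by linarith [midProb_nonneg (s + Q)]⟩
    have hprod : |ε * w * (z - f / 4) * ξ| ≤ ε * w * 2 * 1 := by
      rw [abs_mul, abs_mul, abs_of_pos (by positivity : 0 < ε * w)]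
      have : |z - f / 4| ≤ 2 := by
        rw [abs_le] at *; constructor <;> linarith [hzabs.1, hzabs.2, hfabs.1, hfabs.2]
      gcongr
    have h1 : w / 16 * ε * D ≤ w / 16 * ε * 2 := by gcongr
    have h0 : 0 ≤ w / 16 * ε * D := by positivity
    have h2 : K₀ * ε ^ 2 ≤ K₀ * ε := by gcongr; exact pow_le_of_le_one hε.le hε1.le two_ne_zero
    have h3 : 0 ≤ K₀ * ε ^ 2 := by positivity
    have h4 : 0 ≤ K₀ * ε := by positivity
    have h5 : 0 ≤ w * ε := by positivity
    rw [abs_le] at hprod ⊢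
    rw [hL, hU]
    constructor <;> linarith only [hprod.1, hprod.2, h1, h0, h2, h3, h4, h5]
  have hexpU : Real.exp U ≤ 1 + U + L ^ 2 * ε ^ 2 := by
    have h1 := (abs_le.1 (Real.abs_exp_sub_one_sub_id_le (hUabs.trans hεL.le))).2
    have h2 : U ^ 2 ≤ (ε * L) ^ 2 := by rw [← sq_abs]; gcongr
    linarith only [h1, h2]
  have hV0 : 0 ≤ V := (by positivity : (0 : ℝ) ≤ z ^ 2 / 4).trans
    (sq_div_four_le_lyapunov hQ0.le hQ1.le hb0 hb1 z y)
  have hE1 : 1 ≤ Real.exp V := Real.one_le_exp hV0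
  set E := Real.exp V with hE
  have hmain : Real.exp V' ≤ E * (1 + U + L ^ 2 * ε ^ 2) := by
    calc Real.exp V' ≤ Real.exp (V + U) := Real.exp_le_exp.2 (by linarith)
      _ = E * Real.exp U := Real.exp_add _ _
      _ ≤ _ := by gcongr
  have hED : c * (E - 1) ≤ E * D := by
    have h1 : E * (c * (1 - Real.exp (-V))) ≤ E * D := by gcongr
    have h2 : E * Real.exp (-V) = 1 := by rw [hE, ← Real.exp_add]; simp
    have h3 : E * (c * (1 - Real.exp (-V))) = c * (E - E * Real.exp (-V)) := by ring
    rw [h3, h2] at h1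
    exact h1
  have h1 : w / 16 * ε * (c * (E - 1)) ≤ w / 16 * ε * (E * D) := by gcongr
  have h2 : K * ε * (ε * (E - 1)) ≤ κ * (ε * (E - 1)) := by
    have : 0 ≤ E - 1 := by linarith
    have : K * ε ≤ κ := by linarith
    gcongr
  have e1 : E * (1 + U + L ^ 2 * ε ^ 2) = E - w / 16 * ε * (E * D) + K * ε * (ε * (E - 1))
      + K * ε ^ 2 + E * (ε * w * (z - f / 4)) * ξ := by
    rw [hU, hK]; ring
  have e2 : w / 16 * ε * (c * (E - 1)) = 2 * κ * (ε * (E - 1)) := by rw [hκ]; ring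
  linarith only [hmain, h1, h2, e1, e2]

/-! ### The windowed average -/

lemma windowAvg_zero (γ : ℝ) (m : ℕ → ℝ) : windowAvg γ m 0 = 0 := by simp [windowAvg]

lemma windowAvg_succ (γ : ℝ) (m : ℕ → ℝ) (k : ℕ) :
    windowAvg γ m (k + 1) = γ * windowAvg γ m k + (1 - γ) * m (k + 1) := by
  have h : ∑ j ∈ Finset.Icc 1 k, γ ^ (k + 1 - j) * m j
      = γ * ∑ j ∈ Finset.Icc 1 k, γ ^ (k - j) * m j := by
    rw [Finset.mul_sum]
    refine Finset.sum_congr rfl fun j hj => ?_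
    rw [Nat.sub_add_comm (Finset.mem_Icc.1 hj).2, pow_succ]
    ring
  unfold windowAvg
  rw [Finset.sum_Icc_succ_top (Nat.le_add_left 1 k), Nat.sub_self, h]
  ring

lemma windowAvg_mem {γ : ℝ} (hγ0 : 0 ≤ γ) (hγ1 : γ ≤ 1) {m : ℕ → ℝ} (hm : ∀ k, 0 ≤ m k ∧ m k ≤ 1)
    (k : ℕ) : 0 ≤ windowAvg γ m k ∧ windowAvg γ m k ≤ 1 := by
  induction k with
  | zero => simp [windowAvg_zero]
  | succ k ih =>
    rw [windowAvg_succ]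
    have := hm (k + 1)
    constructor <;> nlinarith

/-! ### Elementary facts on real sequences -/

/-- A nonnegative input `v` that pushes a signal `x` down, and that decays geometrically as long as
the signal is nonpositive, tends to `0`: if the signal stays positive then `v` is summable. -/
lemma tendsto_zero_of_drift {v x : ℕ → ℝ} {γ β : ℝ} (hγ0 : 0 ≤ γ) (hγ1 : γ < 1) (hβ : 0 < β)
    (hv : ∀ k, 0 ≤ v k) (hx : ∀ k, x (k + 1) ≤ x k - β * v k)
    (hdecay : ∀ k, x k ≤ 0 → v (k + 1) ≤ γ * v k) : Tendsto v atTop (nhds 0) := by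
  have hanti : Antitone x := antitone_nat_of_succ_le fun k => by
    have := mul_nonneg hβ.le (hv k)
    linarith [hx k]
  by_cases h : ∃ k, x k ≤ 0
  · obtain ⟨k, hk⟩ := h
    rw [← tendsto_add_atTop_iff_nat k]
    have hbound : ∀ j, v (j + k) ≤ γ ^ j * v k := by
      intro j
      induction j with
      | zero => simp
      | succ j ih =>
        have h1 := hdecay (j + k) ((hanti (Nat.le_add_left k j)).trans hk)
        rw [Nat.add_right_comm, pow_succ', mul_assoc]
        exact h1.trans (by gcongr)
    refine squeeze_zero (fun j => hv _) hbound ?_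
    simpa using (tendsto_pow_atTop_nhds_zero_of_lt_one hγ0 hγ1).mul_const (v k)
  · push Not at h
    have hsum : ∀ k, β * ∑ j ∈ Finset.range k, v j ≤ x 0 - x k := by
      intro k
      induction k with
      | zero => simp
      | succ k ih =>
        rw [Finset.sum_range_succ, mul_add]
        linarith [hx k]
    refine (summable_of_sum_range_le (c := x 0 / β) hv fun k => ?_).tendsto_atTop_zero
    rw [le_div_iff₀ hβ]
    linarith [hsum k, h k]

lemma le_geometric_add_of_affine {u : ℕ → ℝ} {ρ L : ℝ} (hρ : 0 ≤ ρ)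
    (hu : ∀ k, u (k + 1) ≤ ρ * u k + (1 - ρ) * L) (k : ℕ) : u k ≤ ρ ^ k * (u 0 - L) + L := by
  induction k with
  | zero => simp
  | succ k ih =>
    have := mul_le_mul_of_nonneg_left ih hρ
    rw [pow_succ']
    linarith [hu k]

/-! ### The history and the innovations -/

section

variable {Ω : Type*} {n : ℕ} {q : Fin n → ℝ} {Q α β γ : ℝ}
  {M : Fin n → ℕ → Ω → ℝ} {C : ℕ → Ω → ℝ} {c : Fin n → ℕ → Ω → ℝ}

lemma measurable_complianceHistory (M : Fin n → ℕ → Ω → ℝ) (i : Fin n) {j k : ℕ} (hj : 1 ≤ j)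
    (hjk : j ≤ k) : Measurable[complianceHistory M k] (M i j) := by
  rw [measurable_iff_comap_le, BorelSpace.measurable_eq (α := ℝ)]
  exact le_iSup_of_le i (le_iSup₂_of_le j (Finset.mem_Icc.2 ⟨hj, hjk⟩) le_rfl)

lemma complianceHistory_mono (M : Fin n → ℕ → Ω → ℝ) : Monotone (complianceHistory M) := by
  intro k l hkl
  refine iSup_mono fun i => biSup_mono fun j hj => ?_
  rw [Finset.mem_Icc] at hj ⊢
  exact ⟨hj.1, hj.2.trans hkl⟩

lemma measurable_windowAvg (γ : ℝ) (M : Fin n → ℕ → Ω → ℝ) (i : Fin n) (k : ℕ) :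
    Measurable[complianceHistory M k] fun ω => windowAvg γ (fun j => M i j ω) k := by
  unfold windowAvg
  refine Measurable.const_mul (Finset.measurable_sum _ fun j hj => Measurable.const_mul ?_ _) _
  exact measurable_complianceHistory M i (Finset.mem_Icc.1 hj).1 (Finset.mem_Icc.1 hj).2

namespace IsComplianceProcess

variable [MeasurableSpace Ω] {μ : Measure Ω}

lemma history_le (hP : IsComplianceProcess μ q Q α β γ M C c) (k : ℕ) : complianceHistory M k ≤ ‹MeasurableSpace Ω› := by
  refine iSup_le fun i => iSup₂_le fun j _ => ?_
  rw [← BorelSpace.measurable_eq (α := ℝ)]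
  exact (hP.measurable i j).comap_le

lemma mem_Icc (hP : IsComplianceProcess μ q Q α β γ M C c) (i : Fin n) (k : ℕ) (ω : Ω) : 0 ≤ M i k ω ∧ M i k ω ≤ 1 := by
  rcases hP.binary i k ω with h | h <;> simp [h]

lemma mean_mem_Icc (hP : IsComplianceProcess μ q Q α β γ M C c) (k : ℕ) (ω : Ω) :
    0 ≤ (n : ℝ)⁻¹ * ∑ i, M i k ω ∧ (n : ℝ)⁻¹ * ∑ i, M i k ω ≤ 1 := by
  have h0 : 0 ≤ ∑ i, M i k ω := Finset.sum_nonneg fun i _ => (hP.mem_Icc i k ω).1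
  refine ⟨by positivity, ?_⟩
  have h1 : ∑ i, M i k ω ≤ n := by
    simpa using Finset.sum_le_sum fun i (_ : i ∈ Finset.univ) => (hP.mem_Icc i k ω).2
  exact inv_mul_le_one_of_le₀ h1 (Nat.cast_nonneg n)

lemma integrable_midProb (hP : IsComplianceProcess μ q Q α β γ M C c)
    (i : Fin n) (k : ℕ) :
    Integrable (fun ω => midProb (q i + C k ω + c i k ω)) μ :=
  integrable_condExp.congr (hP.cond_prob i k)

lemma integrable_innovation [IsProbabilityMeasure μ]
    (hP : IsComplianceProcess μ q Q α β γ M C c)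
    (i : Fin n) (k : ℕ) :
    Integrable (fun ω => M i (k + 1) ω - midProb (q i + C k ω + c i k ω)) μ := by
  refine Integrable.sub ?_ (hP.integrable_midProb i k)
  refine .of_bound (hP.measurable i (k + 1)).aestronglyMeasurable 1 (.of_forall fun ω => ?_)
  have := hP.mem_Icc i (k + 1) ω
  rw [Real.norm_eq_abs, abs_of_nonneg this.1]
  exact this.2

lemma integrable_mul_innovation [IsProbabilityMeasure μ]
    (hP : IsComplianceProcess μ q Q α β γ M C c)
    (i : Fin n) (k : ℕ) {f : Ω → ℝ} {K : ℝ}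
    (hf : StronglyMeasurable[complianceHistory M k] f) (hK : ∀ ω, |f ω| ≤ K) :
    Integrable (fun ω => f ω * (M i (k + 1) ω - midProb (q i + C k ω + c i k ω))) μ :=
  (hP.integrable_innovation i k).bdd_mul (hf.mono (hP.history_le k)).aestronglyMeasurable
    (.of_forall hK)

/-- The innovation `M i (k + 1) - p (q i + C k + c i k)` is orthogonal to the history. The signal
itself need not be measurable with respect to the history, since it involves the variables
`M j 0`. -/
lemma integral_mul_innovation [IsProbabilityMeasure μ]
    (hP : IsComplianceProcess μ q Q α β γ M C c)
    (i : Fin n) (k : ℕ) {f : Ω → ℝ} {K : ℝ}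
    (hf : StronglyMeasurable[complianceHistory M k] f) (hK : ∀ ω, |f ω| ≤ K) :
    ∫ ω, f ω * (M i (k + 1) ω - midProb (q i + C k ω + c i k ω)) ∂μ = 0 := by
  have hle := hP.history_le k
  have hfm := (hf.mono hle).aestronglyMeasurable (μ := μ)
  set A : Set Ω := {ω | M i (k + 1) ω = 1} with hA
  have hAm : MeasurableSet A := hP.measurable i (k + 1) (measurableSet_singleton 1)
  have hMA : M i (k + 1) = A.indicator fun _ => (1 : ℝ) := by
    ext ω
    by_cases h : M i (k + 1) ω = 1
    · simp [hA, h]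
    · simp [hA, (hP.binary i (k + 1) ω).resolve_right h]
  have hint : Integrable (A.indicator fun _ => (1 : ℝ)) μ :=
    (integrable_const (1 : ℝ)).indicator hAm
  have hfint : Integrable (f * A.indicator fun _ => (1 : ℝ)) μ :=
    hint.bdd_mul hfm (.of_forall hK)
  have hpint := (hP.integrable_midProb i k).bdd_mul hfm (.of_forall hK)
  have h1 : ∫ ω, f ω * M i (k + 1) ω ∂μ = ∫ ω, f ω * midProb (q i + C k ω + c i k ω) ∂μ := by
    rw [hMA]
    change ∫ ω, (f * A.indicator fun _ => (1 : ℝ)) ω ∂μ = _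
    rw [← integral_condExp hle]
    refine integral_congr_ae ?_
    filter_upwards [condExp_mul_of_stronglyMeasurable_left hf hfint hint, hP.cond_prob i k]
      with ω h2 h3
    rw [h2, Pi.mul_apply, h3]
  simp_rw [mul_sub]
  rw [integral_sub _ hpint, h1, sub_self]
  rw [hMA]
  exact hfint

lemma ae_eq_zero_of_signal_nonpos [IsProbabilityMeasure μ]
    (hP : IsComplianceProcess μ q Q α β γ M C c)
    (i : Fin n) (k : ℕ) :
    ∀ᵐ ω ∂μ, q i + C k ω + c i k ω ≤ 0 → M i (k + 1) ω = 0 := by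
  set g := μ⟦{ω | M i (k + 1) ω = 1} | complianceHistory M k⟧ with hg
  set S : Set Ω := {ω | g ω ≤ 0} with hS
  have hSm : MeasurableSet[complianceHistory M k] S :=
    measurableSet_le stronglyMeasurable_condExp.measurable measurable_const
  set f : Ω → ℝ := S.indicator fun _ => 1 with hf
  have hfm : StronglyMeasurable[complianceHistory M k] f := stronglyMeasurable_const.indicator hSm
  have hf1 : ∀ ω, |f ω| ≤ 1 := fun ω => by
    by_cases h : ω ∈ S <;> simp [hf, h]
  have h0 := hP.integral_mul_innovation i k hfm hf1
  rw [integral_eq_zero_iff_of_nonneg_ae _ (hP.integrable_mul_innovation i k hfm hf1)] at h0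
  · filter_upwards [h0, hP.cond_prob i k] with ω h1 h2 hX
    rw [midProb_of_nonpos hX] at h2
    have hωS : ω ∈ S := h2.le
    simpa [hf, hωS, midProb_of_nonpos hX] using h1
  · filter_upwards [hP.cond_prob i k] with ω h2
    by_cases h : ω ∈ S
    · have h3 : g ω ≤ 0 := h
      have := (hP.mem_Icc i (k + 1) ω).1
      simp only [hf, h, Set.indicator_of_mem, one_mul, Pi.zero_apply]
      linarith
    · simp [hf, h]

lemma ae_eq_one_of_one_le_signal [IsProbabilityMeasure μ]
    (hP : IsComplianceProcess μ q Q α β γ M C c)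
    (i : Fin n) (k : ℕ) :
    ∀ᵐ ω ∂μ, 1 ≤ q i + C k ω + c i k ω → M i (k + 1) ω = 1 := by
  set g := μ⟦{ω | M i (k + 1) ω = 1} | complianceHistory M k⟧ with hg
  set S : Set Ω := {ω | 1 ≤ g ω} with hS
  have hSm : MeasurableSet[complianceHistory M k] S :=
    measurableSet_le measurable_const stronglyMeasurable_condExp.measurable
  set f : Ω → ℝ := S.indicator fun _ => -1 with hf
  have hfm : StronglyMeasurable[complianceHistory M k] f := stronglyMeasurable_const.indicator hSm
  have hf1 : ∀ ω, |f ω| ≤ 1 := fun ω => by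
    by_cases h : ω ∈ S <;> simp [hf, h]
  have h0 := hP.integral_mul_innovation i k hfm hf1
  rw [integral_eq_zero_iff_of_nonneg_ae _ (hP.integrable_mul_innovation i k hfm hf1)] at h0
  · filter_upwards [h0, hP.cond_prob i k] with ω h1 h2 hX
    rw [midProb_of_one_le hX] at h2
    have hωS : ω ∈ S := h2.ge
    simp only [hf, hωS, Set.indicator_of_mem, midProb_of_one_le hX, Pi.zero_apply] at h1
    linarith
  · filter_upwards [hP.cond_prob i k] with ω h2
    by_cases h : ω ∈ S
    · have h3 : 1 ≤ g ω := h
      have := (hP.mem_Icc i (k + 1) ω).2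
      simp only [hf, h, Set.indicator_of_mem, Pi.zero_apply]
      linarith
    · simp [hf, h]

/-! ### The targets `0` and `1` -/

lemma ae_tendsto_windowAvg_zero [IsProbabilityMeasure μ]
    (hP : IsComplianceProcess μ q Q α β γ M C c)
    (hQ : Q = 0) (hα : 0 ≤ α) (hβ : 0 < β) (hγ0 : 0 ≤ γ) (hγ1 : γ < 1)
    (i : Fin n) :
    ∀ᵐ ω ∂μ, Tendsto (fun k => windowAvg γ (fun j => M i j ω) k) atTop (nhds 0) := by
  filter_upwards [ae_all_iff.2 (hP.ae_eq_zero_of_signal_nonpos i)] with ω hω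
  refine tendsto_zero_of_drift (x := fun k => q i + C k ω + c i k ω) hγ0 hγ1 hβ
    (fun k => (windowAvg_mem hγ0 hγ1.le (fun j => hP.mem_Icc i j ω) k).1) (fun k => ?_)
    fun k hk => ?_
  · have := mul_nonneg hα (hP.mean_mem_Icc k ω).1
    simp only [hP.global_law, hP.individual_law, hQ]
    linarith
  · rw [windowAvg_succ, hω k hk]
    linarith

lemma ae_tendsto_windowAvg_one [IsProbabilityMeasure μ]
    (hP : IsComplianceProcess μ q Q α β γ M C c)
    (hQ : Q = 1) (hα : 0 ≤ α) (hβ : 0 < β) (hγ0 : 0 ≤ γ) (hγ1 : γ < 1)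
    (i : Fin n) :
    ∀ᵐ ω ∂μ, Tendsto (fun k => windowAvg γ (fun j => M i j ω) k) atTop (nhds 1) := by
  filter_upwards [ae_all_iff.2 (hP.ae_eq_one_of_one_le_signal i)] with ω hω
  have h := tendsto_zero_of_drift (v := fun k => 1 - windowAvg γ (fun j => M i j ω) k)
    (x := fun k => 1 - (q i + C k ω + c i k ω)) hγ0 hγ1 hβ
    (fun k => sub_nonneg.2 (windowAvg_mem hγ0 hγ1.le (fun j => hP.mem_Icc i j ω) k).2)
    (fun k => ?_) fun k hk => ?_
  · simpa using h.const_sub 1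
  · have := mul_nonneg hα (sub_nonneg.2 (hP.mean_mem_Icc k ω).2)
    simp only [hP.global_law, hP.individual_law, hQ]
    linarith
  · rw [windowAvg_succ, hω k (by linarith)]
    linarith

lemma limsup_eq_zero_of_ae_tendsto [IsProbabilityMeasure μ]
    (hP : IsComplianceProcess μ q Q α β γ M C c)
    (i : Fin n)
    (h : ∀ᵐ ω ∂μ, Tendsto (fun k => windowAvg γ (fun j => M i j ω) k) atTop (nhds Q))
    {δ : ℝ} (hδ : 0 < δ) :
    limsup (fun k : ℕ => μ {ω | δ < |windowAvg γ (fun j => M i j ω) k - Q|}) atTop = 0 := by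
  have hm := tendstoInMeasure_of_tendsto_ae
    (fun k => ((measurable_windowAvg γ M i k).mono (hP.history_le k) le_rfl).aestronglyMeasurable) h
  rw [tendstoInMeasure_iff_norm] at hm
  refine (tendsto_of_tendsto_of_tendsto_of_le_of_le tendsto_const_nhds (hm δ hδ)
    (fun _ => zero_le) fun k => measure_mono fun ω hω => ?_).limsup_eq
  exact (Set.mem_ofPred.1 hω).le

end IsComplianceProcess

end

/-! ### Targets in `(0, 1)` -/

section

variable {Ω : Type*} {n : ℕ} {q : Fin n → ℝ} {Q α β γ : ℝ}
  {M : Fin n → ℕ → Ω → ℝ} {C : ℕ → Ω → ℝ} {c : Fin n → ℕ → Ω → ℝ}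

/-- The deviation of agent `i`'s signal at time `k` from the target, with the contribution of the
variables `M j 0` removed. Those variables enter `C k` for `k ≥ 1` but do not belong to the
history, so that this corrected deviation, unlike the signal, is measurable with respect to the
history at every time `k ≥ 1`. -/
noncomputable def signalDeviation (q : Fin n → ℝ) (Q α : ℝ) (M : Fin n → ℕ → Ω → ℝ) (C : ℕ → Ω → ℝ)
    (c : Fin n → ℕ → Ω → ℝ) (i : Fin n) (k : ℕ) (ω : Ω) : ℝ :=
  q i + C k ω + c i k ω + α * ((n : ℝ)⁻¹ * ∑ j, M j 0 ω) - Q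

namespace IsComplianceProcess

variable [MeasurableSpace Ω] {μ : Measure Ω}

lemma signalDeviation_succ (hP : IsComplianceProcess μ q Q α β γ M C c) (i : Fin n) (k : ℕ)
    (ω : Ω) :
    signalDeviation q Q α M C c i (k + 1) ω = signalDeviation q Q α M C c i k ω
      - β * (windowAvg γ (fun j => M i j ω) k - Q) + α * (Q - (n : ℝ)⁻¹ * ∑ j, M j k ω) := by
  simp only [signalDeviation, hP.global_law, hP.individual_law]
  ring

lemma signalDeviation_one (hP : IsComplianceProcess μ q Q α β γ M C c) {C₀ : ℝ} {c₀ : Fin n → ℝ}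
    (hC : ∀ ω, C 0 ω = C₀) (hc : ∀ i ω, c i 0 ω = c₀ i) (i : Fin n) (ω : Ω) :
    signalDeviation q Q α M C c i 1 ω = q i + C₀ + c₀ i + α * Q + β * Q - Q := by
  rw [← zero_add 1, hP.signalDeviation_succ, windowAvg_zero, signalDeviation, hC, hc]
  ring

lemma abs_signal_sub_signalDeviation_le (hP : IsComplianceProcess μ q Q α β γ M C c) (hα : 0 ≤ α)
    (i : Fin n) (k : ℕ) (ω : Ω) :
    |q i + C k ω + c i k ω - Q - signalDeviation q Q α M C c i k ω| ≤ α := by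
  have h := hP.mean_mem_Icc 0 ω
  have e : q i + C k ω + c i k ω - Q - signalDeviation q Q α M C c i k ω
      = -(α * ((n : ℝ)⁻¹ * ∑ j, M j 0 ω)) := by
    unfold signalDeviation; ring
  rw [e, abs_neg, abs_of_nonneg (mul_nonneg hα h.1)]
  exact mul_le_of_le_one_right hα h.2

lemma measurable_signalDeviation (hP : IsComplianceProcess μ q Q α β γ M C c) {C₀ : ℝ}
    {c₀ : Fin n → ℝ} (hC : ∀ ω, C 0 ω = C₀) (hc : ∀ i ω, c i 0 ω = c₀ i) (i : Fin n) (k : ℕ) :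
    Measurable[complianceHistory M (k + 1)] (signalDeviation q Q α M C c i (k + 1)) := by
  induction k with
  | zero =>
    rw [zero_add, funext (hP.signalDeviation_one hC hc i)]
    exact measurable_const
  | succ k ih =>
    rw [funext (hP.signalDeviation_succ i (k + 1))]
    have hmono := complianceHistory_mono M (Nat.le_succ (k + 1))
    refine Measurable.add (Measurable.sub (ih.mono hmono le_rfl) ?_) ?_
    · exact (((measurable_windowAvg γ M i (k + 1)).mono hmono le_rfl).sub_const Q).const_mul β
    · refine Measurable.const_mul (Measurable.const_sub (Measurable.const_mul ?_ _) Q) α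
      exact Finset.measurable_sum _ fun j _ =>
        measurable_complianceHistory M j (Nat.le_add_left 1 k) (Nat.le_succ _)

lemma windowAvg_sub_mem (hP : IsComplianceProcess μ q Q α β γ M C c) (hγ0 : 0 ≤ γ) (hγ1 : γ ≤ 1)
    (i : Fin n) (k : ℕ) (ω : Ω) : -Q ≤ windowAvg γ (fun j => M i j ω) k - Q ∧
      windowAvg γ (fun j => M i j ω) k - Q ≤ 1 - Q := by
  have := windowAvg_mem hγ0 hγ1 (fun j => hP.mem_Icc i j ω) k
  constructor <;> linarith

lemma abs_windowAvg_sub_le (hP : IsComplianceProcess μ q Q α β γ M C c) (hQ0 : 0 ≤ Q) (hQ1 : Q ≤ 1)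
    (hγ0 : 0 ≤ γ) (hγ1 : γ ≤ 1) (i : Fin n) (k : ℕ) (ω : Ω) :
    |windowAvg γ (fun j => M i j ω) k - Q| ≤ 1 := by
  have := hP.windowAvg_sub_mem hγ0 hγ1 i k ω
  exact abs_le.2 ⟨by linarith, by linarith⟩

lemma abs_target_sub_mean_le (hP : IsComplianceProcess μ q Q α β γ M C c) (hQ0 : 0 ≤ Q)
    (hQ1 : Q ≤ 1) (k : ℕ) (ω : Ω) : |Q - (n : ℝ)⁻¹ * ∑ j, M j k ω| ≤ 1 := by
  have := hP.mean_mem_Icc k ω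
  exact abs_le.2 ⟨by linarith, by linarith⟩

lemma exists_abs_signalDeviation_le (hP : IsComplianceProcess μ q Q α β γ M C c) (hQ0 : 0 ≤ Q)
    (hQ1 : Q ≤ 1) (hγ0 : 0 ≤ γ) (hγ1 : γ ≤ 1) {C₀ : ℝ}
    {c₀ : Fin n → ℝ} (hC : ∀ ω, C 0 ω = C₀) (hc : ∀ i ω, c i 0 ω = c₀ i) (i : Fin n) (k : ℕ) :
    ∃ Y, ∀ ω, |signalDeviation q Q α M C c i (k + 1) ω| ≤ Y := by
  induction k with
  | zero => exact ⟨_, fun ω => (congrArg abs (hP.signalDeviation_one hC hc i ω)).le⟩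
  | succ k ih =>
    obtain ⟨Y, hY⟩ := ih
    refine ⟨Y + |β| * 1 + |α| * 1, fun ω => ?_⟩
    rw [hP.signalDeviation_succ]
    refine (abs_add_le _ _).trans (add_le_add ((abs_sub _ _).trans (add_le_add (hY ω) ?_)) ?_)
    · rw [abs_mul]
      exact mul_le_mul_of_nonneg_left (hP.abs_windowAvg_sub_le hQ0 hQ1 hγ0 hγ1 i _ ω)
        (abs_nonneg _)
    · rw [abs_mul]
      exact mul_le_mul_of_nonneg_left (hP.abs_target_sub_mean_le hQ0 hQ1 _ ω) (abs_nonneg _)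

/-- For an interior target, the expected exponential Lyapunov function contracts at rate of order
`ε` towards a level of order `ε`, and Markov's inequality turns this into the bound on the
probability of a deviation. -/
lemma exists_limsup_le {Q b w A : ℝ} (hQ0 : 0 < Q) (hQ1 : Q < 1) (hA : 0 < A) (hb0 : 0 < b)
    (hb1 : b ≤ 1) (hw : 0 < w) :
    ∃ B : ℝ, 0 < B ∧ ∃ ε₀ : ℝ, 0 < ε₀ ∧
      ∀ ε : ℝ, 0 < ε → ε < ε₀ →
      ∀ (n : ℕ) (q : Fin n → ℝ) (C₀ : ℝ) (c₀ : Fin n → ℝ)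
        (Ω : Type*) [MeasurableSpace Ω] (μ : Measure Ω) [IsProbabilityMeasure μ]
        (M : Fin n → ℕ → Ω → ℝ) (C : ℕ → Ω → ℝ) (c : Fin n → ℕ → Ω → ℝ),
        IsComplianceProcess μ q Q (ε ^ (3 / 2 : ℝ) * A) (ε * b * w) (1 - ε * w) M C c →
        (∀ ω, C 0 ω = C₀) → (∀ i ω, c i 0 ω = c₀ i) →
      ∀ (δ : ℝ), 0 < δ → ∀ i : Fin n,
        limsup (fun k : ℕ =>
            μ {ω | δ < |windowAvg (1 - ε * w) (fun j => M i j ω) k - Q|}) atTop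
          ≤ ENNReal.ofReal (B * (δ ^ 2)⁻¹ * ε) := by
  obtain ⟨κ, hκ, K, hK, ε₀, hε₀, hε₀w, hε₀κ, hstep⟩ :=
    exists_exp_lyapunov_step hQ0 hQ1 hb0 hb1 hw hA
  refine ⟨4 * (K / κ), by positivity, ε₀, hε₀, ?_⟩
  intro ε hε hεε₀ n q C₀ c₀ Ω _ μ _ M C c hP hC hc δ hδ i
  have hr : ε ^ (3 / 2 : ℝ) = ε * √ε := by
    rw [Real.sqrt_eq_rpow, show (3 / 2 : ℝ) = 1 + 1 / 2 by norm_num, Real.rpow_add hε,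
      Real.rpow_one]
  rw [hr] at hP
  have hεw : ε * w ≤ 1 := (mul_le_mul_of_nonneg_right hεε₀.le hw.le).trans hε₀w
  have hεκ : ε * κ ≤ 1 := (mul_le_mul_of_nonneg_right hεε₀.le hκ.le).trans hε₀κ
  have hγ0 : 0 ≤ 1 - ε * w := sub_nonneg.2 hεw
  have hγ1 : 1 - ε * w ≤ 1 := by linarith [mul_pos hε hw]
  set Z : ℕ → Ω → ℝ := fun k ω => windowAvg (1 - ε * w) (fun j => M i j ω) k - Q with hZ
  set Y : ℕ → Ω → ℝ := fun k ω => signalDeviation q Q (ε * √ε * A) M C c i k ω with hY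
  set E : ℕ → Ω → ℝ := fun k ω => Real.exp (lyapunov Q b (Z k ω) (Y k ω)) with hE
  have hZm : ∀ k, Measurable[complianceHistory M k] (Z k) := fun k =>
    (measurable_windowAvg (1 - ε * w) M i k).sub_const Q
  have hYm : ∀ k, Measurable[complianceHistory M (k + 1)] (Y (k + 1)) :=
    hP.measurable_signalDeviation hC hc i
  have hEm : ∀ k, Measurable[complianceHistory M (k + 1)] (E (k + 1)) := fun k =>
    Real.measurable_exp.comp
      ((continuous_lyapunov Q b).measurable.comp ((hZm (k + 1)).prodMk (hYm k)))
  have hZ1 : ∀ k ω, |Z k ω| ≤ 1 := hP.abs_windowAvg_sub_le hQ0.le hQ1.le hγ0 hγ1 i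
  have hEbdd : ∀ k, ∃ R, 0 ≤ R ∧ ∀ ω, |E (k + 1) ω| ≤ R := by
    intro k
    obtain ⟨R, hR⟩ := hP.exists_abs_signalDeviation_le hQ0.le hQ1.le hγ0 hγ1 hC hc i k
    refine ⟨Real.exp (1 + R / b), (Real.exp_pos _).le, fun ω => ?_⟩
    rw [abs_of_pos (Real.exp_pos _), Real.exp_le_exp]
    exact lyapunov_le hQ0.le hQ1.le hb0 (hZ1 _ ω) (hR ω)
  have hEint : ∀ k, Integrable (E (k + 1)) μ := by
    intro k
    obtain ⟨R, -, hR⟩ := hEbdd k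
    exact .of_bound ((hEm k).mono (hP.history_le _) le_rfl).aestronglyMeasurable R (.of_forall hR)
  have hWint : ∀ k, Integrable (fun ω => E (k + 1) ω - 1) μ := fun k =>
    (hEint k).sub (integrable_const 1)
  have hWlow : ∀ k ω, Z k ω ^ 2 / 4 ≤ E k ω - 1 := fun k ω => by
    have h1 := sq_div_four_le_lyapunov hQ0.le hQ1.le hb0 hb1 (Z k ω) (Y k ω)
    have h2 := Real.add_one_le_exp (lyapunov Q b (Z k ω) (Y k ω))
    linarith
  set u : ℕ → ℝ := fun k => ∫ ω, (E (k + 1) ω - 1) ∂μ with hu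
  have hu_step : ∀ k, u (k + 1) ≤ (1 - κ * ε) * u k + (1 - (1 - κ * ε)) * (K / κ * ε) := by
    intro k
    set f : Ω → ℝ := fun ω =>
      E (k + 1) ω * (ε * w * (Z (k + 1) ω - centeredProb Q (Y (k + 1) ω) / 4)) with hf
    have hfm : StronglyMeasurable[complianceHistory M (k + 1)] f := by
      refine Measurable.stronglyMeasurable ((hEm k).mul (Measurable.const_mul
        ((hZm (k + 1)).sub (Measurable.div_const ?_ 4)) (ε * w)))
      exact (continuous_centeredProb Q).measurable.comp (hYm k)
    obtain ⟨R, hR0, hR⟩ := hEbdd k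
    have hfbdd : ∀ ω, |f ω| ≤ R * (ε * w * 2) := by
      intro ω
      have h1 := abs_le.1 (hZ1 (k + 1) ω)
      have h2 := abs_le.1 (abs_centeredProb_le_one hQ0.le hQ1.le (Y (k + 1) ω))
      have h3 : |Z (k + 1) ω - centeredProb Q (Y (k + 1) ω) / 4| ≤ 2 :=
        abs_le.2 ⟨by linarith, by linarith⟩
      rw [hf, abs_mul, abs_mul (ε * w), abs_of_pos (mul_pos hε hw)]
      exact mul_le_mul (hR ω) (by gcongr) (by positivity) hR0
    have hfint := hP.integrable_mul_innovation i (k + 1) hfm hfbdd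
    have hpath : ∀ ω, E (k + 2) ω - 1 ≤ ((1 - κ * ε) * (E (k + 1) ω - 1) + K * ε ^ 2)
        + f ω * (M i (k + 2) ω - midProb (q i + C (k + 1) ω + c i (k + 1) ω)) := by
      intro ω
      have hz := hP.windowAvg_sub_mem hγ0 hγ1 i (k + 1) ω
      have hx := hP.mem_Icc i (k + 2) ω
      have h := hstep ε (√ε) (Z (k + 1) ω) (Y (k + 1) ω)
        (q i + C (k + 1) ω + c i (k + 1) ω - Q) (Q - (n : ℝ)⁻¹ * ∑ j, M j (k + 1) ω)
        (M i (k + 2) ω) hε hεε₀ (Real.sqrt_nonneg ε) (Real.sq_sqrt hε.le) hz.1 hz.2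
        (hP.abs_target_sub_mean_le hQ0.le hQ1.le (k + 1) ω) hx.1 hx.2
        (hP.abs_signal_sub_signalDeviation_le (by positivity) i (k + 1) ω)
      have hZs : Z (k + 1) ω + ε * w * (M i (k + 2) ω - Q - Z (k + 1) ω) = Z (k + 2) ω := by
        simp only [hZ, windowAvg_succ _ _ (k + 1)]
        ring
      have hYs : Y (k + 1) ω - ε * w * b * Z (k + 1) ω
          + ε * √ε * A * (Q - (n : ℝ)⁻¹ * ∑ j, M j (k + 1) ω) = Y (k + 2) ω := by
        simp only [hY, hZ, hP.signalDeviation_succ i (k + 1)]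
        ring
      rw [hZs, hYs, sub_add_cancel] at h
      exact h
    have haff : Integrable (fun ω => (1 - κ * ε) * (E (k + 1) ω - 1) + K * ε ^ 2) μ :=
      ((hWint k).const_mul _).add (integrable_const _)
    calc u (k + 1) ≤ ∫ ω, (((1 - κ * ε) * (E (k + 1) ω - 1) + K * ε ^ 2)
          + f ω * (M i (k + 2) ω - midProb (q i + C (k + 1) ω + c i (k + 1) ω))) ∂μ :=
          integral_mono (hWint (k + 1)) (haff.add hfint) hpath
      _ = (1 - κ * ε) * u k + K * ε ^ 2 := by
          rw [integral_add haff hfint, hP.integral_mul_innovation i (k + 1) hfm hfbdd, add_zero,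
            integral_add ((hWint k).const_mul _) (integrable_const _), integral_const_mul,
            integral_const, probReal_univ, one_smul]
      _ = _ := by field_simp; ring
  have hρ0 : 0 ≤ 1 - κ * ε := by linarith
  have hρ1 : 1 - κ * ε < 1 := by linarith [mul_pos hκ hε]
  have hu_le := le_geometric_add_of_affine hρ0 hu_step
  have hmarkov : ∀ k, μ {ω | δ < |Z (k + 1) ω|} ≤ ENNReal.ofReal (4 * (δ ^ 2)⁻¹
      * ((1 - κ * ε) ^ k * (u 0 - K / κ * ε) + K / κ * ε)) := by
    intro k
    have h1 := mul_meas_ge_le_integral_of_nonneg (μ := μ) (f := fun ω => E (k + 1) ω - 1)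
      (.of_forall fun ω => (by positivity : 0 ≤ Z (k + 1) ω ^ 2 / 4).trans (hWlow (k + 1) ω))
      (hWint k) (δ ^ 2 / 4)
    have hsub : {ω | δ < |Z (k + 1) ω|} ⊆ {ω | δ ^ 2 / 4 ≤ E (k + 1) ω - 1} := by
      intro ω hω
      have h2 : δ < |Z (k + 1) ω| := hω
      have h3 : δ ^ 2 ≤ Z (k + 1) ω ^ 2 := by rw [← sq_abs (Z (k + 1) ω)]; gcongr
      have h4 := hWlow (k + 1) ω
      change δ ^ 2 / 4 ≤ E (k + 1) ω - 1
      linarith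
    refine (measure_mono hsub).trans ?_
    rw [← ofReal_measureReal]
    refine ENNReal.ofReal_le_ofReal ?_
    calc _ = 4 * (δ ^ 2)⁻¹ * (δ ^ 2 / 4 * μ.real {ω | δ ^ 2 / 4 ≤ E (k + 1) ω - 1}) := by
          field_simp
      _ ≤ 4 * (δ ^ 2)⁻¹ * u k := by gcongr
      _ ≤ _ := by gcongr; exact hu_le k
  have hlim : Tendsto (fun k : ℕ => ENNReal.ofReal (4 * (δ ^ 2)⁻¹
      * ((1 - κ * ε) ^ k * (u 0 - K / κ * ε) + K / κ * ε))) atTop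
      (nhds (ENNReal.ofReal (4 * (K / κ) * (δ ^ 2)⁻¹ * ε))) := by
    refine ENNReal.tendsto_ofReal ?_
    have h := ((((tendsto_pow_atTop_nhds_zero_of_lt_one hρ0 hρ1).mul_const
      (u 0 - K / κ * ε)).add_const (K / κ * ε)).const_mul (4 * (δ ^ 2)⁻¹))
    convert h using 2
    ring
  rw [← limsup_nat_add _ 1]
  exact (limsup_le_limsup (.of_forall hmarkov)).trans hlim.limsup_eq.le

end IsComplianceProcess

end

theorem theorem1 (Q α₀ β₀ w : ℝ) (hQ0 : 0 ≤ Q) (hQ1 : Q ≤ 1) (hα₀ : 0 < α₀)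
    (hβ₀ : 0 < β₀) (hβ₁ : β₀ ≤ 1) (hw : 0 < w) :
    ∃ B : ℝ, 0 < B ∧ ∃ ε₀ : ℝ, 0 < ε₀ ∧
      ∀ ε : ℝ, 0 < ε → ε < ε₀ →
      ∀ (n : ℕ) (q : Fin n → ℝ) (C₀ : ℝ) (c₀ : Fin n → ℝ),
        (∀ i, 0 ≤ q i + C₀ + c₀ i ∧ q i + C₀ + c₀ i ≤ 1) →
      ∀ (Ω : Type*) [MeasurableSpace Ω] (μ : Measure Ω) [IsProbabilityMeasure μ]
        (M : Fin n → ℕ → Ω → ℝ) (C : ℕ → Ω → ℝ) (c : Fin n → ℕ → Ω → ℝ),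
        IsComplianceProcess μ q Q (ε ^ (3 / 2 : ℝ) * α₀) (ε * β₀ * w) (1 - ε * w) M C c →
        (∀ ω, C 0 ω = C₀) → (∀ i ω, c i 0 ω = c₀ i) →
      ∀ (δ : ℝ), 0 < δ → ∀ i : Fin n,
        limsup (fun k : ℕ =>
            μ {ω | δ < |windowAvg (1 - ε * w) (fun j => M i j ω) k - Q|}) atTop
          ≤ ENNReal.ofReal (B * (δ ^ 2)⁻¹ * ε) := by
  by_cases hQ : 0 < Q ∧ Q < 1
  · obtain ⟨B, hB, ε₀, hε₀, h⟩ :=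
      IsComplianceProcess.exists_limsup_le hQ.1 hQ.2 hα₀ hβ₀ hβ₁ hw
    exact ⟨B, hB, ε₀, hε₀, fun ε hε hεε₀ n q C₀ c₀ _ => h ε hε hεε₀ n q C₀ c₀⟩
  · refine ⟨1, one_pos, 1 / w, by positivity, ?_⟩
    intro ε hε hεw n q C₀ c₀ _ Ω _ μ _ M C c hP _ _ δ hδ i
    rw [lt_div_iff₀ hw] at hεw
    have hγ0 : 0 ≤ 1 - ε * w := by linarith
    have hγ1 : 1 - ε * w < 1 := by linarith [mul_pos hε hw]
    have hae : ∀ᵐ ω ∂μ,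
        Tendsto (fun k => windowAvg (1 - ε * w) (fun j => M i j ω) k) atTop (nhds Q) := by
      rcases hQ0.eq_or_lt with h | h
      · rw [← h] at hP ⊢
        exact hP.ae_tendsto_windowAvg_zero rfl (by positivity) (by positivity) hγ0 hγ1 i
      · obtain rfl : Q = 1 := hQ1.antisymm (not_lt.1 fun h' => hQ ⟨h, h'⟩)
        exact hP.ae_tendsto_windowAvg_one rfl (by positivity) (by positivity) hγ0 hγ1 i
    rw [hP.limsup_eq_zero_of_ae_tendsto i hae hδ]
    exact zero_le
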